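/- Let $K$ be a compact metric space. All functions are real-valued, and $C(K)$ is the set of continuous functions $K\to\mathbb{R}$. Define the following classes of functions $F:K\to\mathbb{R}$. * $B_1(K)$ is the set of bounded Baire-1 functions, i.e. the pointwise limits of uniformly bounded, pointwise convergent sequences $(f_n)\subseteq C(K)$. * $DBSC(K)$ is the set of all $F$ for which there exist a constant $C<\infty$ and a sequence $(f_n)_{n=0}^\infty\subseteq C(K)$ with $f_0\equiv 0$ that converges pointwise to $F$ and satisfies $\sum_{n=0}^\infty |f_{n+1}(k)-f_n(k)|\le C$ for all $k\in K$. For $F\in DBSC(K)$, $|F|_D$ denotes the infimum of all such constants $C$. * $B_{1/2}(K)$ is the set of all $F\in B_1(K)$ that are uniform limits of sequences $(F_n)\subseteq DBSC(K)$. * $B_{1/4}(K)$ is the set of all $F\in B_1(K)$ that are uniform limits of sequences $(F_n)\subseteq DBSC(K)$ with $\sup_n|F_n|_D<\infty$. **Proposition 5.1.** If $K$ is an uncountable compact metric space, then $$C(K)\subsetneq DBSC(K)\subsetneq B_{1/4}(K)\subsetneq B_{1/2}(K)\subsetneq B_1(K).$$ -/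

import Mathlib

open Filter Topology
open scoped NNReal ENNReal

namespace BaireOne

/-- The (real-valued) continuous functions on `K`, as a class of functions `K → ℝ`. -/
def CK (K : Type*) [TopologicalSpace K] : Set (K → ℝ) :=
  {F | Continuous F}

/-- `B₁(K)`: the bounded Baire-1 functions on `K`, i.e. the pointwise limits of uniformly bounded
sequences of continuous functions. -/
def B1 (K : Type*) [TopologicalSpace K] : Set (K → ℝ) :=
  {F | ∃ f : ℕ → C(K, ℝ), (∃ M : ℝ, ∀ n k, |f n k| ≤ M) ∧
    ∀ k, Tendsto (fun n => f n k) atTop (𝓝 (F k))}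

/-- There are continuous `f₀ ≡ 0, f₁, f₂, …` converging pointwise to `F` such that
`∑ₙ |fₙ₊₁(k) - fₙ(k)| ≤ C` for every `k`. The sum is taken in `[0, ∞]`, so that the inequality
includes the convergence of the series. -/
def HasVariationBound {K : Type*} [TopologicalSpace K] (F : K → ℝ) (C : ℝ≥0) : Prop :=
  ∃ f : ℕ → C(K, ℝ), f 0 = 0 ∧ (∀ k, Tendsto (fun n => f n k) atTop (𝓝 (F k))) ∧
    ∀ k, ∑' n, ENNReal.ofReal |f (n + 1) k - f n k| ≤ (C : ℝ≥0∞)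

/-- `DBSC(K)`: the differences of bounded semicontinuous functions on `K`. -/
def DBSC (K : Type*) [TopologicalSpace K] : Set (K → ℝ) :=
  {F | ∃ C : ℝ≥0, HasVariationBound F C}

/-- `|F|_D`, the infimum of the constants `C` admissible for `F`; it is `∞` outside `DBSC(K)`. -/
noncomputable def dNorm {K : Type*} [TopologicalSpace K] (F : K → ℝ) : ℝ≥0∞ :=
  ⨅ (C : ℝ≥0) (_ : HasVariationBound F C), (C : ℝ≥0∞)

/-- `B_{1/2}(K)`: the functions in `B₁(K)` that are uniform limits of sequences in `DBSC(K)`. -/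
def BHalf (K : Type*) [TopologicalSpace K] : Set (K → ℝ) :=
  {F | F ∈ B1 K ∧ ∃ G : ℕ → K → ℝ, (∀ n, G n ∈ DBSC K) ∧ TendstoUniformly G F atTop}

/-- `B_{1/4}(K)`: the functions in `B₁(K)` that are uniform limits of sequences in `DBSC(K)`
that are bounded for `|·|_D`. -/
def BQuarter (K : Type*) [TopologicalSpace K] : Set (K → ℝ) :=
  {F | F ∈ B1 K ∧ ∃ G : ℕ → K → ℝ, (∀ n, G n ∈ DBSC K) ∧ (⨆ n, dNorm (G n)) < ∞ ∧
    TendstoUniformly G F atTop}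

end BaireOne

/-! The inclusions are soft; for the first to be strict, take the indicator of a non-isolated point.
For the other three, `K` contains a closed copy of Cantor space. Extension by zero carries the
classes from the copy to `K` (`HasVariationBound.extend` loses a factor 2) and restriction carries
them back, so examples on `ℕ → Bool` suffice.

There a machine reads bits. A block opened at position `j` has value alternating between `a j` and
`0` at each of the next `ℓ` ones, so it contributes variation `ℓ * a j`. Conversely, at a finitely
supported point, one more `true` far out is a jump of the limit at a nearby point; nesting such
jumps forces every approximating sequence to oscillate (`Oscillates.of_frequently_jump`,
`oscillates_of_counter`).

With `a j = 1 / (j + 1)`, length `2 * (j + 1)` makes every block cost 2: unboundedly many blocks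
exclude `DBSC`, while deleting the weights beyond `N` gives close functions of bounded norm. Length
`(j + 1) ^ 2` makes block costs unbounded, excluding `BQuarter`. With `a = 1` and a single block of
arbitrary length, even functions uniformly close to the limit have infinite norm, excluding `BHalf`.
-/

namespace BaireOne

/-! ### Partial-sum form of the variation bound, and the inclusions. -/

section Basic

variable {X : Type*} [TopologicalSpace X]

theorem tsum_ofReal_le_iff {u : ℕ → ℝ} (hu : ∀ i, 0 ≤ u i) {C : ℝ≥0} :
    ∑' i, ENNReal.ofReal (u i) ≤ (C : ℝ≥0∞) ↔ ∀ n, ∑ i ∈ Finset.range n, u i ≤ C := by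
  have key : ∀ n, ∑ i ∈ Finset.range n, ENNReal.ofReal (u i) ≤ (C : ℝ≥0∞) ↔
      ∑ i ∈ Finset.range n, u i ≤ C := fun n => by
    rw [← ENNReal.ofReal_sum_of_nonneg fun i _ => hu i, ← ENNReal.ofReal_coe_nnreal]
    exact ENNReal.ofReal_le_ofReal_iff C.2
  rw [ENNReal.tsum_eq_iSup_nat, iSup_le_iff]
  exact forall_congr' key

theorem hasVariationBound_iff {F : X → ℝ} {C : ℝ≥0} :
    HasVariationBound F C ↔ ∃ f : ℕ → C(X, ℝ), f 0 = 0 ∧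
      (∀ k, Tendsto (fun n => f n k) atTop (𝓝 (F k))) ∧
      ∀ k n, ∑ i ∈ Finset.range n, |f (i + 1) k - f i k| ≤ C := by
  simp only [HasVariationBound, tsum_ofReal_le_iff fun _ => abs_nonneg _]

theorem HasVariationBound.mono {F : X → ℝ} {C D : ℝ≥0} (h : HasVariationBound F C)
    (hCD : C ≤ D) : HasVariationBound F D := by
  obtain ⟨f, h0, hf, hs⟩ := h
  exact ⟨f, h0, hf, fun k => (hs k).trans (by exact_mod_cast hCD)⟩

theorem abs_le_of_variation_le {f : ℕ → C(X, ℝ)} (h0 : f 0 = 0) {C : ℝ} {k : X}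
    (hs : ∀ n, ∑ i ∈ Finset.range n, |f (i + 1) k - f i k| ≤ C) (n : ℕ) : |f n k| ≤ C := by
  have h := Finset.abs_sum_le_sum_abs (fun i => f (i + 1) k - f i k) (Finset.range n)
  rw [Finset.sum_range_sub (fun i => f i k), h0] at h
  simpa using h.trans (hs n)

theorem DBSC_subset_B1 : DBSC X ⊆ B1 X := by
  rintro F ⟨C, h⟩
  obtain ⟨f, h0, hf, hs⟩ := hasVariationBound_iff.1 h
  exact ⟨f, ⟨C, fun n k => abs_le_of_variation_le h0 (hs k) n⟩, hf⟩

theorem CK_subset_DBSC [CompactSpace X] : CK X ⊆ DBSC X := by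
  intro F hF
  obtain ⟨M, hM⟩ := isCompact_univ.exists_bound_of_continuousOn (f := F) hF.continuousOn
  refine ⟨M.toNNReal, hasVariationBound_iff.2
    ⟨fun n => if n = 0 then 0 else ⟨F, hF⟩, by simp, fun k => ?_, fun k n => ?_⟩⟩
  · refine tendsto_const_nhds.congr' ?_
    filter_upwards [eventually_ne_atTop 0] with n hn
    simp only [hn, if_false]
    rfl
  · have hM0 : 0 ≤ M := (norm_nonneg _).trans (hM k trivial)
    rw [Real.coe_toNNReal M hM0]
    rcases n with _ | n
    · simpa using hM0
    · rw [Finset.sum_range_succ']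
      have h0 : (⟨F, hF⟩ : C(X, ℝ)) k = F k := rfl
      simpa [h0] using hM k trivial

/-- Any constant strictly above the finite supremum of the norms is admissible for all `G n` at
once. -/
theorem mem_BQuarter_iff {F : X → ℝ} :
    F ∈ BQuarter X ↔ F ∈ B1 X ∧ ∃ (C : ℝ≥0) (G : ℕ → X → ℝ),
      (∀ n, HasVariationBound (G n) C) ∧ TendstoUniformly G F atTop := by
  refine and_congr_right fun _ => ⟨?_, ?_⟩
  · rintro ⟨G, -, hlt, hu⟩
    obtain ⟨C, hC, -⟩ := ENNReal.lt_iff_exists_nnreal_btwn.1 hlt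
    refine ⟨C, G, fun n => ?_, hu⟩
    have h := (le_iSup (fun n => dNorm (G n)) n).trans_lt hC
    simp only [dNorm, iInf_lt_iff] at h
    obtain ⟨D, hD, hDC⟩ := h
    exact hD.mono (by exact_mod_cast hDC.le)
  · rintro ⟨C, G, hG, hu⟩
    exact ⟨G, fun n => ⟨C, hG n⟩,
      (iSup_le fun n => iInf₂_le C (hG n)).trans_lt ENNReal.coe_lt_top, hu⟩

theorem DBSC_subset_BQuarter : DBSC X ⊆ BQuarter X := by
  intro F hF
  obtain ⟨C, hC⟩ := id hF
  refine mem_BQuarter_iff.2 ⟨DBSC_subset_B1 hF, C, fun _ => F, fun _ => hC, ?_⟩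
  exact fun u hu => Eventually.of_forall fun _ _ => refl_mem_uniformity hu

theorem BQuarter_subset_BHalf : BQuarter X ⊆ BHalf X :=
  fun _ ⟨h, G, hG, _, hu⟩ => ⟨h, G, hG, hu⟩

end Basic

/-! ### Restriction to, and extension by zero from, a closed subspace. -/

section Transfer

variable {L K : Type*} [TopologicalSpace L]

theorem HasVariationBound.comp [TopologicalSpace K] {F : K → ℝ} {C : ℝ≥0}
    (h : HasVariationBound F C) (φ : C(L, K)) : HasVariationBound (F ∘ φ) C := by
  obtain ⟨f, h0, hf, hs⟩ := h
  exact ⟨fun n => (f n).comp φ, by simp [h0], fun k => hf (φ k), fun k => hs (φ k)⟩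

theorem B1_comp [TopologicalSpace K] {F : K → ℝ} (h : F ∈ B1 K) (φ : C(L, K)) :
    F ∘ φ ∈ B1 L := by
  obtain ⟨f, ⟨M, hM⟩, hf⟩ := h
  exact ⟨fun n => (f n).comp φ, ⟨M, fun n k => hM n (φ k)⟩, fun k => hf (φ k)⟩

theorem BHalf_comp [TopologicalSpace K] {F : K → ℝ} (h : F ∈ BHalf K) (φ : C(L, K)) :
    F ∘ φ ∈ BHalf L := by
  obtain ⟨h1, G, hG, hu⟩ := h
  exact ⟨B1_comp h1 φ, fun n => G n ∘ φ, fun n => (hG n).imp fun C hC => hC.comp φ, hu.comp φ⟩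

theorem BQuarter_comp [TopologicalSpace K] {F : K → ℝ} (h : F ∈ BQuarter K) (φ : C(L, K)) :
    F ∘ φ ∈ BQuarter L := by
  obtain ⟨h1, C, G, hG, hu⟩ := mem_BQuarter_iff.1 h
  exact mem_BQuarter_iff.2 ⟨B1_comp h1 φ, C, fun n => G n ∘ φ, fun n => (hG n).comp φ, hu.comp φ⟩

variable [MetricSpace K]

/-- Continuous functions that are `1` on `S` and decrease to `0` off `closure S`. -/
noncomputable def cutoff (S : Set K) (n : ℕ) : C(K, ℝ) where
  toFun k := max 0 (1 - n * Metric.infDist k S)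
  continuous_toFun := continuous_const.max
    (continuous_const.sub (continuous_const.mul (Metric.continuous_infDist_pt S)))

theorem cutoff_nonneg (S : Set K) (n : ℕ) (k : K) : 0 ≤ cutoff S n k := le_max_left _ _

theorem cutoff_le_one (S : Set K) (n : ℕ) (k : K) : cutoff S n k ≤ 1 :=
  max_le zero_le_one (sub_le_self _ (mul_nonneg n.cast_nonneg Metric.infDist_nonneg))

theorem cutoff_succ_le (S : Set K) (n : ℕ) (k : K) : cutoff S (n + 1) k ≤ cutoff S n k := by
  have := Metric.infDist_nonneg (x := k) (s := S)
  refine max_le_max le_rfl ?_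
  push_cast
  nlinarith

theorem cutoff_of_mem {S : Set K} (n : ℕ) {k : K} (hk : k ∈ S) : cutoff S n k = 1 := by
  simp [cutoff, Metric.infDist_zero_of_mem hk]

theorem eventually_cutoff_eq_zero {S : Set K} (hS : IsClosed S) (hne : S.Nonempty) {k : K}
    (hk : k ∉ S) : ∀ᶠ n in atTop, cutoff S n k = 0 := by
  have hpos := (hS.notMem_iff_infDist_pos hne).1 hk
  obtain ⟨N, hN⟩ := exists_nat_ge (1 / Metric.infDist k S)
  filter_upwards [eventually_ge_atTop N] with n hn
  refine max_eq_left (sub_nonpos.2 ?_)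
  rw [← div_le_iff₀ hpos]
  exact hN.trans (by exact_mod_cast hn)

theorem tendsto_extend [Nonempty L] {φ : L → K} (hφ : IsClosedEmbedding φ) {F : L → ℝ}
    {f : ℕ → C(L, ℝ)} (hf : ∀ x, Tendsto (fun n => f n x) atTop (𝓝 (F x))) {g : ℕ → C(K, ℝ)}
    (hg : ∀ n x, g n (φ x) = f n x) (k : K) :
    Tendsto (fun n => (g n * cutoff (Set.range φ) n) k) atTop (𝓝 (Function.extend φ F 0 k)) := by
  by_cases hk : k ∈ Set.range φ
  · obtain ⟨x, rfl⟩ := hk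
    rw [hφ.injective.extend_apply]
    simpa [hg, cutoff_of_mem] using hf x
  · rw [Function.extend_apply' _ _ _ hk]
    refine tendsto_const_nhds.congr' ?_
    filter_upwards [eventually_cutoff_eq_zero hφ.isClosed_range (Set.range_nonempty φ) hk]
      with n hn
    simp [hn]

theorem exists_extension_of_abs_le {φ : L → K} (hφ : IsClosedEmbedding φ) (f : C(L, ℝ))
    (h : C(K, ℝ)) (h0 : ∀ k, 0 ≤ h k) (hf : ∀ x, |f x| ≤ h (φ x)) :
    ∃ g : C(K, ℝ), (∀ x, g (φ x) = f x) ∧ ∀ k, |g k| ≤ h k := by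
  obtain ⟨e, he⟩ := f.exists_extension hφ
  refine ⟨(-h) ⊔ (h ⊓ e), fun x => ?_, fun k => ?_⟩
  · have := congrArg (fun u : C(L, ℝ) => u x) he
    simp only [ContinuousMap.comp_apply, ContinuousMap.coe_mk] at this
    have h1 := abs_le.1 (hf x)
    simp [this, h1.1, h1.2]
  · have := h0 k
    rw [abs_le]
    exact ⟨le_sup_left, sup_le (neg_le_self this) inf_le_left⟩

theorem B1_extend [Nonempty L] {φ : L → K} (hφ : IsClosedEmbedding φ) {F : L → ℝ}
    (hF : F ∈ B1 L) : Function.extend φ F 0 ∈ B1 K := by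
  obtain ⟨f, ⟨M, hM⟩, hf⟩ := hF
  have hM0 : 0 ≤ M := (abs_nonneg _).trans (hM 0 (Classical.arbitrary L))
  choose g hg hgM using fun n =>
    exists_extension_of_abs_le hφ (f n) (ContinuousMap.const K M) (fun _ => hM0) (hM n)
  refine ⟨fun n => g n * cutoff (Set.range φ) n, ⟨M, fun n k => ?_⟩, tendsto_extend hφ hf hg⟩
  rw [ContinuousMap.mul_apply, abs_mul, abs_of_nonneg (cutoff_nonneg _ n k)]
  exact (mul_le_of_le_one_right (abs_nonneg _) (cutoff_le_one _ n k)).trans (hgM n k)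

/-- The increments are extended one at a time by Tietze, each truncated to the budget `C` minus the
variation already spent. On `L` the truncation changes nothing, since `f` respects the budget there.
-/
theorem exists_extension_variation_le {φ : L → K} (hφ : IsClosedEmbedding φ) {f : ℕ → C(L, ℝ)}
    (h0 : f 0 = 0) {C : ℝ} (hC : 0 ≤ C)
    (hs : ∀ x n, ∑ i ∈ Finset.range n, |f (i + 1) x - f i x| ≤ C) :
    ∃ g : ℕ → C(K, ℝ), g 0 = 0 ∧ (∀ n x, g n (φ x) = f n x) ∧
      ∀ k n, ∑ i ∈ Finset.range n, |g (i + 1) k - g i k| ≤ C := by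
  -- In a pair `p`, the first entry is the current extension and the second the variation spent. The
  -- conditions on `p` are premises inside the existential, so that `choose` yields a total function
  -- to recurse on.
  have step : ∀ (n : ℕ) (p : C(K, ℝ) × C(K, ℝ)), ∃ q : C(K, ℝ),
      ((∀ x, p.2 (φ x) = ∑ i ∈ Finset.range n, |f (i + 1) x - f i x|) → (∀ k, p.2 k ≤ C) →
        (∀ x, q (φ x) = f (n + 1) x - f n x) ∧ ∀ k, |q k| ≤ C - p.2 k) := by
    intro n p
    by_cases hp : (∀ x, p.2 (φ x) = ∑ i ∈ Finset.range n, |f (i + 1) x - f i x|) ∧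
      ∀ k, p.2 k ≤ C
    · obtain ⟨q, hq⟩ := exists_extension_of_abs_le hφ (f (n + 1) - f n)
        (ContinuousMap.const K C - p.2) (fun k => sub_nonneg.2 (hp.2 k)) (fun x => by
          have := hs x (n + 1)
          rw [Finset.sum_range_succ, ← hp.1 x] at this
          simpa using le_sub_iff_add_le'.2 this)
      exact ⟨q, fun _ _ => hq⟩
    · exact ⟨0, fun h1 h2 => absurd ⟨h1, h2⟩ hp⟩
  choose d hd using step
  let s : ℕ → C(K, ℝ) × C(K, ℝ) := fun n =>
    Nat.rec (0, 0) (fun n p => (p.1 + d n p, p.2 + |d n p|)) n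
  have hs1 : ∀ n, (s (n + 1)).1 = (s n).1 + d n (s n) := fun n => rfl
  have hs2 : ∀ n, (s (n + 1)).2 = (s n).2 + |d n (s n)| := fun n => rfl
  have inv : ∀ n, (∀ x, (s n).2 (φ x) = ∑ i ∈ Finset.range n, |f (i + 1) x - f i x|) ∧
      (∀ k, (s n).2 k ≤ C) ∧ ∀ x, (s n).1 (φ x) = f n x := by
    intro n
    induction n with
    | zero => exact ⟨fun x => by simp [s], fun k => by simpa [s] using hC, fun x => by simp [s, h0]⟩
    | succ n ih =>
      obtain ⟨i1, i2, i3⟩ := ih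
      obtain ⟨j1, j2⟩ := hd n (s n) i1 i2
      refine ⟨fun x => ?_, fun k => ?_, fun x => ?_⟩
      · rw [hs2, Finset.sum_range_succ, ContinuousMap.add_apply, i1, ContinuousMap.abs_apply, j1]
      · rw [hs2, ContinuousMap.add_apply, ContinuousMap.abs_apply]
        linarith [j2 k]
      · rw [hs1, ContinuousMap.add_apply, i3, j1]
        ring
  refine ⟨fun n => (s n).1, rfl, fun n => (inv n).2.2, fun k n => ?_⟩
  refine le_trans (le_of_eq ?_) ((inv n).2.1 k)
  induction n with
  | zero => simp [s]
  | succ n ih =>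
    rw [Finset.sum_range_succ, ih, hs2]
    simp [hs1]

/-- The cutoffs kill the extension off the range. They decrease from at most 1, and `|g i| ≤ C`, so
they add at most another `C` to the variation. -/
theorem HasVariationBound.extend [Nonempty L] {φ : L → K} (hφ : IsClosedEmbedding φ) {F : L → ℝ}
    {C : ℝ≥0} (h : HasVariationBound F C) : HasVariationBound (Function.extend φ F 0) (2 * C) := by
  obtain ⟨f, h0, hf, hs⟩ := hasVariationBound_iff.1 h
  obtain ⟨g, g0, hg, hgs⟩ := exists_extension_variation_le hφ h0 C.coe_nonneg hs
  refine hasVariationBound_iff.2 ⟨fun n => g n * cutoff (Set.range φ) n, by simp [g0],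
    tendsto_extend hφ hf hg, fun k n => ?_⟩
  set χ : ℕ → ℝ := fun n => cutoff (Set.range φ) n k with hχ
  have hb : ∀ i, |(g (i + 1) * cutoff (Set.range φ) (i + 1)) k - (g i * cutoff (Set.range φ) i) k|
      ≤ |g (i + 1) k - g i k| + C * (χ i - χ (i + 1)) := by
    intro i
    have e : (g (i + 1) * cutoff (Set.range φ) (i + 1)) k - (g i * cutoff (Set.range φ) i) k
        = (g (i + 1) k - g i k) * χ (i + 1) - g i k * (χ i - χ (i + 1)) := by
      simp only [ContinuousMap.mul_apply, hχ]
      ring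
    have h1 : 0 ≤ χ i - χ (i + 1) := sub_nonneg.2 (cutoff_succ_le _ i k)
    rw [e]
    refine (abs_sub _ _).trans (add_le_add ?_ ?_)
    · rw [abs_mul, abs_of_nonneg (cutoff_nonneg _ _ k : 0 ≤ χ (i + 1))]
      exact mul_le_of_le_one_right (abs_nonneg _) (cutoff_le_one _ _ k)
    · rw [abs_mul, abs_of_nonneg h1]
      exact mul_le_mul_of_nonneg_right (abs_le_of_variation_le g0 (hgs k) i) h1
  refine (Finset.sum_le_sum fun i _ => hb i).trans ?_
  rw [Finset.sum_add_distrib, ← Finset.mul_sum, Finset.sum_range_sub']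
  have h2 : (C : ℝ) * (χ 0 - χ n) ≤ C * 1 :=
    mul_le_mul_of_nonneg_left ((sub_le_self _ (cutoff_nonneg _ n k)).trans
      (cutoff_le_one _ 0 k)) C.coe_nonneg
  refine (add_le_add (hgs k n) h2).trans (le_of_eq ?_)
  push_cast
  ring

theorem tendstoUniformly_extend {φ : L → K} (hφ : IsClosedEmbedding φ) {G : ℕ → L → ℝ}
    {F : L → ℝ} (h : TendstoUniformly G F atTop) :
    TendstoUniformly (fun n => Function.extend φ (G n) 0) (Function.extend φ F 0) atTop := by
  intro u hu
  filter_upwards [h u hu] with n hn k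
  by_cases hk : k ∈ Set.range φ
  · obtain ⟨x, rfl⟩ := hk
    simpa only [hφ.injective.extend_apply] using hn x
  · rw [Function.extend_apply' _ _ _ hk, Function.extend_apply' _ _ _ hk]
    exact refl_mem_uniformity hu

theorem BHalf_extend [Nonempty L] {φ : L → K} (hφ : IsClosedEmbedding φ) {F : L → ℝ}
    (hF : F ∈ BHalf L) : Function.extend φ F 0 ∈ BHalf K := by
  obtain ⟨h1, G, hG, hu⟩ := hF
  exact ⟨B1_extend hφ h1, _, fun n => (hG n).elim fun C hC => ⟨_, hC.extend hφ⟩,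
    tendstoUniformly_extend hφ hu⟩

theorem BQuarter_extend [Nonempty L] {φ : L → K} (hφ : IsClosedEmbedding φ) {F : L → ℝ}
    (hF : F ∈ BQuarter L) : Function.extend φ F 0 ∈ BQuarter K := by
  obtain ⟨h1, C, G, hG, hu⟩ := mem_BQuarter_iff.1 hF
  exact mem_BQuarter_iff.2 ⟨B1_extend hφ h1, _, _, fun n => (hG n).extend hφ,
    tendstoUniformly_extend hφ hu⟩

theorem not_DBSC_subset_CK [CompactSpace K] [Infinite K] : ¬ DBSC K ⊆ CK K := by
  intro hsub
  obtain ⟨x, hx⟩ : ∃ x : K, ¬ IsOpen {x} := by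
    by_contra! hall
    have := discreteTopology_iff_isOpen_singleton.2 hall
    exact not_finite_iff_infinite.2 ‹_› (finite_of_compact_of_discrete (X := K))
  have hφ : IsClosedEmbedding (fun _ : Unit => x) :=
    (continuous_const.isClosedEmbedding fun _ _ _ => rfl)
  have h1 : (fun _ : Unit => (1 : ℝ)) ∈ DBSC Unit := CK_subset_DBSC continuous_const
  obtain ⟨C, hC⟩ := h1
  have hcont : Continuous (Function.extend (fun _ : Unit => x) (fun _ => (1 : ℝ)) 0) :=
    hsub ⟨_, hC.extend hφ⟩
  refine hx ?_
  convert isOpen_ne_fun hcont continuous_zero using 1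
  ext k
  by_cases hk : k = x
  · subst hk
    simpa using (hφ.injective.extend_apply (fun _ => (1 : ℝ)) 0 ()).symm ▸ one_ne_zero
  · rw [Set.mem_ofPred_eq, Function.extend_apply' _ _ _ (by rintro ⟨_, h⟩; exact hk h.symm)]
    simpa using hk

end Transfer

/-! ### Lower bounds for the variation of approximating sequences. -/

section Oscillation

variable {X : Type*} [TopologicalSpace X]

/-- Arbitrarily close to `x`, the tails of `f` have variation greater than `c`. -/
def Oscillates (f : ℕ → C(X, ℝ)) (x : X) (c : ℝ) : Prop :=
  ∀ U ∈ 𝓝 x, ∀ N, ∃ z ∈ U, ∃ M, N ≤ M ∧ c < ∑ i ∈ Finset.Ico N M, |f (i + 1) z - f i z|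

theorem Oscillates.of_neg (f : ℕ → C(X, ℝ)) (x : X) {c : ℝ} (hc : c < 0) : Oscillates f x c :=
  fun _ hU N => ⟨x, mem_of_mem_nhds hU, N, le_rfl, by simpa using hc⟩

theorem Oscillates.mono {f : ℕ → C(X, ℝ)} {x : X} {c d : ℝ} (h : Oscillates f x c)
    (hd : d ≤ c) : Oscillates f x d := fun U hU N =>
  let ⟨z, hz, M, hM, hs⟩ := h U hU N
  ⟨z, hz, M, hM, hd.trans_lt hs⟩

theorem Oscillates.of_frequently {f : ℕ → C(X, ℝ)} {x : X} {c : ℝ}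
    (h : ∃ᶠ y in 𝓝 x, Oscillates f y c) : Oscillates f x c := by
  intro U hU N
  obtain ⟨y, hy, hyU⟩ := (h.and_eventually (eventually_mem_nhds_iff.2 hU)).exists
  exact hy U hyU N

theorem Oscillates.lt_of_variation_le {f : ℕ → C(X, ℝ)} {x : X} {c C : ℝ} (h : Oscillates f x c)
    (hs : ∀ k n, ∑ i ∈ Finset.range n, |f (i + 1) k - f i k| ≤ C) : c < C := by
  obtain ⟨z, -, M, -, hM⟩ := h Set.univ univ_mem 0
  rw [← Finset.range_eq_Ico] at hM
  exact hM.trans_le (hs z M)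

theorem abs_sub_le_sum_Ico (u : ℕ → ℝ) {M N : ℕ} (h : M ≤ N) :
    |u N - u M| ≤ ∑ i ∈ Finset.Ico M N, |u (i + 1) - u i| := by
  rw [← Finset.sum_Ico_sub u h]
  exact Finset.abs_sum_le_sum_abs _ _

/-- By continuity some `f N₁` is close to `G x` near `x`, and a later `f N₂` is close to `G y` near
a suitable `y`. Points near `y` thus vary by more than `b` between `N₁` and `N₂`, and some such
point varies by more than `c` after `N₂`. -/
theorem Oscillates.of_frequently_jump {f : ℕ → C(X, ℝ)} {G : X → ℝ}
    (hf : ∀ k, Tendsto (fun n => f n k) atTop (𝓝 (G k))) {x : X} {b b' c : ℝ} (hb : b < b')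
    (h : ∃ᶠ y in 𝓝 x, b' ≤ |G y - G x| ∧ Oscillates f y c) : Oscillates f x (c + b) := by
  obtain ⟨δ, hδ, hδb⟩ : ∃ δ > 0, b + 2 * δ = b' := ⟨(b' - b) / 2, by linarith, by ring⟩
  have freeze : ∀ (y : X) (N : ℕ), ∃ M, N ≤ M ∧ ∀ᶠ z in 𝓝 y, |f M z - G y| < δ := by
    intro y N
    have h1 : ∀ᶠ n in atTop, |f n y - G y| < δ := by
      simpa [Real.dist_eq] using (Metric.tendsto_nhds.1 (hf y)) δ hδ
    obtain ⟨M, hM, hNM⟩ := (h1.and (eventually_ge_atTop N)).exists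
    exact ⟨M, hNM, (((f M).continuous.sub continuous_const).abs.continuousAt).eventually_lt
      continuousAt_const hM⟩
  intro U hU N
  obtain ⟨N₁, hN₁, h₁⟩ := freeze x N
  obtain ⟨y, ⟨hyb, hyo⟩, hy⟩ :=
    (h.and_eventually (eventually_eventually_nhds.2 (h₁.and hU))).exists
  obtain ⟨N₂, hN₂, h₂⟩ := freeze y N₁
  obtain ⟨z, ⟨⟨hz₁, hzU⟩, hz₂⟩, M, hM, hsum⟩ := hyo _ (hy.and h₂) N₂
  refine ⟨z, hzU, M, hN₁.trans (hN₂.trans hM), ?_⟩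
  rw [← Finset.sum_Ico_consecutive _ (hN₁.trans hN₂) hM, ← Finset.sum_Ico_consecutive _ hN₁ hN₂]
  have e₁ : 0 ≤ ∑ i ∈ Finset.Ico N N₁, |f (i + 1) z - f i z| :=
    Finset.sum_nonneg fun _ _ => abs_nonneg _
  have e₂ := abs_sub_le_sum_Ico (fun i => f i z) hN₂
  have e₃ : |G y - G x| ≤ |f N₂ z - f N₁ z| + |f N₁ z - G x| + |f N₂ z - G y| := by
    rw [show G y - G x = (f N₂ z - f N₁ z) + (f N₁ z - G x) - (f N₂ z - G y) by ring]
    exact (abs_sub _ _).trans (add_le_add_left (abs_add_le _ _) _)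
  linarith

end Oscillation

/-! ### The block machine on Cantor space and upper bounds for its variation. -/

section Cantor

/-- State, after reading `x 0, …, x (n - 1)`, of a machine with states `(j, r)`. Reading a one
decreases the counter `r`; if `r = 0`, reading a one at position `n` starts a new block, with
`j = n` and with counter `ℓ j n`. -/
def blockState (ℓ : ℕ → ℕ → ℕ) (x : ℕ → Bool) : ℕ → ℕ × ℕ
  | 0 => (0, 0)
  | n + 1 =>
    if x n then
      if (blockState ℓ x n).2 = 0 then (n, ℓ (blockState ℓ x n).1 n)
      else ((blockState ℓ x n).1, (blockState ℓ x n).2 - 1)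
    else blockState ℓ x n

/-- The value `a j` at states whose counter is odd, and zero at the others. -/
noncomputable def blockValue (a : ℕ → ℝ) (s : ℕ × ℕ) : ℝ := if Odd s.2 then a s.1 else 0

variable {ℓ : ℕ → ℕ → ℕ} {a : ℕ → ℝ} {x : ℕ → Bool} {n : ℕ}

theorem blockState_succ_of_false (h : x n = false) :
    blockState ℓ x (n + 1) = blockState ℓ x n := by
  simp [blockState, h]

theorem blockState_succ_of_true_of_zero (h : x n = true) (h0 : (blockState ℓ x n).2 = 0) :
    blockState ℓ x (n + 1) = (n, ℓ (blockState ℓ x n).1 n) := by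
  simp [blockState, h, h0]

theorem blockState_succ_of_true_of_ne (h : x n = true) (h0 : (blockState ℓ x n).2 ≠ 0) :
    blockState ℓ x (n + 1) = ((blockState ℓ x n).1, (blockState ℓ x n).2 - 1) := by
  simp [blockState, h, h0]

theorem blockState_congr {y : ℕ → Bool} (h : ∀ i < n, x i = y i) :
    blockState ℓ x n = blockState ℓ y n := by
  induction n with
  | zero => rfl
  | succ n ih =>
    simp only [blockState, ih fun i hi => h i (hi.trans n.lt_succ_self), h n n.lt_succ_self]

theorem blockState_of_eventually_false {m : ℕ} (h : ∀ i, m ≤ i → x i = false) (hn : m ≤ n) :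
    blockState ℓ x n = blockState ℓ x m := by
  induction n, hn using Nat.le_induction with
  | base => rfl
  | succ n hn ih => rw [blockState_succ_of_false (h n hn), ih]

theorem continuous_blockState (ℓ : ℕ → ℕ → ℕ) (n : ℕ) :
    Continuous fun x : ℕ → Bool => blockState ℓ x n := by
  refine continuous_iff_continuousAt.2 fun x => ?_
  refine (continuousAt_const (y := blockState ℓ x n)).congr ?_
  have h : ∀ᶠ y in 𝓝 x, ∀ i < n, y i = x i := by
    refine (Set.finite_lt_nat n).eventually_all.2 fun i _ => ?_
    exact ((continuous_apply i).tendsto x).eventually (p := (· = x i)) (by simp [nhds_discrete])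
  filter_upwards [h] with y hy
  exact (blockState_congr hy).symm

/-- The functions `x ↦ blockValue a (blockState ℓ x n)`, which are continuous. -/
noncomputable def blockFun (ℓ : ℕ → ℕ → ℕ) (a : ℕ → ℝ) (n : ℕ) : C(ℕ → Bool, ℝ) where
  toFun x := blockValue a (blockState ℓ x n)
  continuous_toFun := (continuous_of_discreteTopology (f := blockValue a)).comp (continuous_blockState ℓ n)

theorem blockFun_apply : blockFun ℓ a n x = blockValue a (blockState ℓ x n) := rfl

theorem abs_blockValue_le {A : ℝ} (ha : ∀ j, |a j| ≤ A) (s : ℕ × ℕ) : |blockValue a s| ≤ A := by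
  unfold blockValue
  split_ifs
  · exact ha _
  · simpa using (abs_nonneg _).trans (ha 0)

theorem abs_blockValue_sub_pred {j r : ℕ} :
    |blockValue a (j, r) - blockValue a (j, r + 1)| = |a j| := by
  unfold blockValue
  by_cases h : Odd r
  · simp [h, Nat.odd_add_one]
  · simp [h, Nat.odd_add_one]

theorem counter_mul_le {B : ℝ} (hB0 : 0 ≤ B) (hB : ∀ i j, ℓ i j * a j ≤ B) (ha : ∀ j, 0 ≤ a j)
    (x : ℕ → Bool) (n : ℕ) : (blockState ℓ x n).2 * a (blockState ℓ x n).1 ≤ B := by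
  induction n with
  | zero => simpa [blockState] using hB0
  | succ n ih =>
    rcases Bool.eq_false_or_eq_true (x n) with h | h
    · by_cases h0 : (blockState ℓ x n).2 = 0
      · rw [blockState_succ_of_true_of_zero h h0]
        exact hB _ _
      · rw [blockState_succ_of_true_of_ne h h0]
        refine le_trans (mul_le_mul_of_nonneg_right ?_ (ha _)) ih
        exact_mod_cast Nat.sub_le _ _
    · rwa [blockState_succ_of_false h]

/-- Counter times weight is a potential: each one read inside a block pays for a jump of size `a j`,
and blocks opened from time `N` on have weight zero. -/
theorem variation_add_counter_le {N : ℕ} (ha : ∀ j, 0 ≤ a j) (haN : ∀ j, N ≤ j → a j = 0)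
    (x : ℕ → Bool) (n : ℕ) :
    ∑ i ∈ Finset.range n, |blockFun ℓ a (N + i + 1) x - blockFun ℓ a (N + i) x| +
      (blockState ℓ x (N + n)).2 * a (blockState ℓ x (N + n)).1 ≤
    (blockState ℓ x N).2 * a (blockState ℓ x N).1 := by
  induction n with
  | zero => simp
  | succ n ih =>
    refine le_trans ?_ ih
    rw [Finset.sum_range_succ, add_assoc]
    refine add_le_add_right ?_ _
    rw [blockFun_apply, blockFun_apply, ← add_assoc N n 1]
    rcases Bool.eq_false_or_eq_true (x (N + n)) with h | h
    · by_cases h0 : (blockState ℓ x (N + n)).2 = 0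
      · rw [blockState_succ_of_true_of_zero h h0]
        simp [blockValue, h0, haN (N + n) (Nat.le_add_right _ _)]
      · rw [blockState_succ_of_true_of_ne h h0]
        obtain ⟨j, r, hs⟩ : ∃ j r, blockState ℓ x (N + n) = (j, r + 1) :=
          ⟨(blockState ℓ x (N + n)).1, (blockState ℓ x (N + n)).2 - 1, by
            rw [Nat.sub_add_cancel (Nat.pos_of_ne_zero h0)]⟩
        rw [hs]
        simp only [Nat.add_sub_cancel]
        rw [abs_blockValue_sub_pred, abs_of_nonneg (ha j)]
        push_cast
        linarith
    · rw [blockState_succ_of_false h]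
      simp

theorem exists_limit_of_variation_le {X : Type*} [TopologicalSpace X] {f : ℕ → C(X, ℝ)} {C : ℝ}
    (hs : ∀ k n, ∑ i ∈ Finset.range n, |f (i + 1) k - f i k| ≤ C) :
    ∃ F : X → ℝ, ∀ k, Tendsto (fun n => f n k) atTop (𝓝 (F k)) := by
  choose F hF using fun k => cauchySeq_tendsto_of_complete
    (cauchySeq_of_summable_dist (f := fun n => f n k)
      (summable_of_sum_range_le (fun _ => dist_nonneg) fun n => by
        simpa only [Real.dist_eq, abs_sub_comm (f _ k) (f (_ + 1) k)] using hs k n))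
  exact ⟨F, hF⟩

theorem exists_hasVariationBound_of_eventually_zero {N : ℕ} {A B : ℝ≥0} (ha : ∀ j, 0 ≤ a j)
    (haA : ∀ j, a j ≤ A) (haN : ∀ j, N ≤ j → a j = 0) (hB : ∀ i j, ℓ i j * a j ≤ B) :
    ∃ G : (ℕ → Bool) → ℝ, HasVariationBound G (A + B) ∧
      ∀ x, Tendsto (fun n => blockFun ℓ a n x) atTop (𝓝 (G x)) := by
  -- Jumping from `0` straight to time `N` costs at most `A` and skips all earlier blocks; only the
  -- block open at time `N` still costs, at most `B`.
  let h : ℕ → C(ℕ → Bool, ℝ) := fun n => Nat.casesOn n 0 fun i => blockFun ℓ a (N + i)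
  have hsum : ∀ x n, ∑ i ∈ Finset.range n, |h (i + 1) x - h i x| ≤ ((A + B : ℝ≥0) : ℝ) := by
    intro x n
    rcases n with _ | n
    · simpa using (A + B).2
    · rw [Finset.sum_range_succ', add_comm]
      push_cast
      refine add_le_add ?_ ?_
      · simpa [h, blockFun_apply] using abs_blockValue_le
          (fun j => (abs_of_nonneg (ha j)).trans_le (haA j)) (blockState ℓ x N)
      · have h1 := variation_add_counter_le (ℓ := ℓ) ha haN x n
        have h2 := counter_mul_le B.2 hB ha x N
        have h3 : 0 ≤ ((blockState ℓ x (N + n)).2 : ℝ) * a (blockState ℓ x (N + n)).1 :=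
          mul_nonneg (Nat.cast_nonneg _) (ha _)
        exact (le_add_of_nonneg_right h3).trans (h1.trans h2)
  obtain ⟨G, hG⟩ := exists_limit_of_variation_le hsum
  refine ⟨G, hasVariationBound_iff.2 ⟨h, rfl, hG, hsum⟩, fun x => ?_⟩
  have h1 : (fun i => h (i + (N + 1)) x) = fun i => blockFun ℓ a (i + 2 * N) x := by
    funext i
    have : i + (N + 1) = (i + N) + 1 := by ring
    rw [this]
    change blockFun ℓ a (N + (i + N)) x = _
    congr 2
    ring
  refine (tendsto_add_atTop_iff_nat (2 * N)).1 ?_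
  rw [← h1]
  exact (tendsto_add_atTop_iff_nat (f := fun i => h i x) (N + 1)).2 (hG x)

/-- The sequence `1 / (j + 1)`. -/
noncomputable def harmonicWeight (j : ℕ) : ℝ := 1 / ((j : ℝ) + 1)

theorem harmonicWeight_pos (j : ℕ) : 0 < harmonicWeight j := Nat.one_div_pos_of_nat

theorem harmonicWeight_anti : Antitone harmonicWeight := fun _ _ h => Nat.one_div_le_one_div h

theorem harmonicWeight_le_one (j : ℕ) : harmonicWeight j ≤ 1 := by
  simpa [harmonicWeight] using harmonicWeight_anti j.zero_le

/-- Setting the weights from index `N` on to zero changes each `blockFun` by at most `harmonicWeight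
N`, so the limits of the truncated functions approximate uniformly. -/
theorem exists_limit_harmonic {B : ℕ → ℝ≥0}
    (hB : ∀ N i j, j < N → ℓ i j * harmonicWeight j ≤ B N) :
    ∃ F : (ℕ → Bool) → ℝ, F ∈ B1 (ℕ → Bool) ∧
      (∀ x, Tendsto (fun n => blockFun ℓ harmonicWeight n x) atTop (𝓝 (F x))) ∧
      ∃ G : ℕ → (ℕ → Bool) → ℝ, (∀ N, HasVariationBound (G N) (1 + B N)) ∧
        TendstoUniformly G F atTop := by
  let b : ℕ → ℕ → ℝ := fun N j => if j < N then harmonicWeight j else 0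
  have hb0 : ∀ N j, 0 ≤ b N j := fun N j => by
    simp only [b]; split_ifs
    exacts [(harmonicWeight_pos j).le, le_rfl]
  have hb1 : ∀ N j, b N j ≤ (1 : ℝ≥0) := fun N j => by
    simp only [b]; split_ifs
    exacts [harmonicWeight_le_one j, zero_le_one]
  have hbN : ∀ N j, N ≤ j → b N j = 0 := fun N j h => if_neg h.not_gt
  have hbB : ∀ N i j, ℓ i j * b N j ≤ B N := fun N i j => by
    by_cases h : j < N
    · simpa [b, h] using hB N i j h
    · simp [b, h]
  choose G hGv hG using fun N =>
    exists_hasVariationBound_of_eventually_zero (ℓ := ℓ) (hb0 N) (hb1 N) (hbN N) (hbB N)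
  have hclose : ∀ N n x, |blockFun ℓ harmonicWeight n x - blockFun ℓ (b N) n x| ≤
      harmonicWeight N := by
    intro N n x
    rw [blockFun_apply, blockFun_apply]
    unfold blockValue
    have := (harmonicWeight_pos N).le
    split_ifs with h
    · by_cases hj : (blockState ℓ x n).1 < N
      · simpa [b, hj] using this
      · simpa [b, hj, abs_of_pos (harmonicWeight_pos _)] using harmonicWeight_anti (not_lt.1 hj)
    · simpa using this
  have hw : Tendsto harmonicWeight atTop (𝓝 0) := tendsto_one_div_add_atTop_nhds_zero_nat
  have hlim : ∀ x, ∃ y, Tendsto (fun n => blockFun ℓ harmonicWeight n x) atTop (𝓝 y) := by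
    intro x
    refine cauchySeq_tendsto_of_complete (Metric.cauchySeq_iff'.2 fun ε hε => ?_)
    obtain ⟨N, hN⟩ := (hw.eventually_lt_const (show (0 : ℝ) < ε / 3 by positivity)).exists
    obtain ⟨M, hM⟩ := Metric.cauchySeq_iff'.1 (hG N x).cauchySeq (ε / 3) (by positivity)
    refine ⟨M, fun n hn => ?_⟩
    have h1 := hM n hn
    have h2 := hclose N n x
    have h3 := hclose N M x
    rw [Real.dist_eq, abs_lt] at *
    rw [abs_le] at h2 h3
    constructor <;> linarith [h1.1, h1.2, h2.1, h2.2, h3.1, h3.2]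
  choose F hF using hlim
  refine ⟨F, ⟨blockFun ℓ harmonicWeight, ⟨1, fun n k => ?_⟩, hF⟩, hF, G, hGv, ?_⟩
  · exact abs_blockValue_le (fun j => (abs_of_pos (harmonicWeight_pos j)).trans_le
      (harmonicWeight_le_one j)) _
  · refine Metric.tendstoUniformly_iff.2 fun ε hε => ?_
    filter_upwards [hw.eventually_lt_const hε] with N hN x
    exact (le_of_tendsto ((hF x).sub (hG N x)).abs
      (Eventually.of_forall fun n => hclose N n x)).trans_lt hN

end Cantor

/-! ### Lower bounds for block functions, and the three separating examples. -/

section Lower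

variable {ℓ : ℕ → ℕ → ℕ} {a : ℕ → ℝ}

theorem tendsto_update_true (x : ℕ → Bool) :
    Tendsto (fun n => Function.update x n true) atTop (𝓝 x) := by
  refine tendsto_pi_nhds.2 fun i => tendsto_const_nhds.congr' ?_
  filter_upwards [eventually_gt_atTop i] with n hn
  rw [Function.update_of_ne hn.ne]

theorem update_true_eq_false {x : ℕ → Bool} {m n : ℕ} (hx : ∀ i, m ≤ i → x i = false)
    (hn : m ≤ n) : ∀ i, n + 1 ≤ i → Function.update x n true i = false := fun i hi => by
  rw [Function.update_of_ne (by lia)]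
  exact hx i (by lia)

theorem blockState_update {x : ℕ → Bool} {m n : ℕ} (hx : ∀ i, m ≤ i → x i = false)
    (hn : m ≤ n) : blockState ℓ (Function.update x n true) n = blockState ℓ x m := by
  rw [← blockState_of_eventually_false hx hn]
  exact blockState_congr fun i hi => Function.update_of_ne hi.ne _ _

theorem limit_eq_blockValue {F : (ℕ → Bool) → ℝ}
    (hF : ∀ x, Tendsto (fun n => blockFun ℓ a n x) atTop (𝓝 (F x))) {x : ℕ → Bool} {m : ℕ}
    (hx : ∀ i, m ≤ i → x i = false) : F x = blockValue a (blockState ℓ x m) := by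
  refine tendsto_nhds_unique (hF x) (tendsto_const_nhds.congr' ?_)
  filter_upwards [eventually_ge_atTop m] with n hn
  rw [blockFun_apply, blockState_of_eventually_false hx hn]

/-- Inside a block with parameter `j` whose counter is `r`, the approximations to a function near
the limit of `blockFun ℓ a` oscillate `r` times by almost `a j`. -/
theorem oscillates_of_counter {F G : (ℕ → Bool) → ℝ}
    (hF : ∀ x, Tendsto (fun n => blockFun ℓ a n x) atTop (𝓝 (F x))) {η : ℝ}
    (hGF : ∀ x, |G x - F x| ≤ η) {f : ℕ → C(ℕ → Bool, ℝ)}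
    (hf : ∀ x, Tendsto (fun n => f n x) atTop (𝓝 (G x))) {j : ℕ} {b c : ℝ} (ha : 0 ≤ a j)
    (hb : b + 2 * η < a j)
    (hc : ∀ x m, (∀ i, m ≤ i → x i = false) → (blockState ℓ x m).2 = 0 → Oscillates f x c)
    (r : ℕ) : ∀ x m, (∀ i, m ≤ i → x i = false) → blockState ℓ x m = (j, r) →
      Oscillates f x (c + r * b) := by
  induction r with
  | zero =>
    intro x m hx hs
    simpa using hc x m hx (by rw [hs])
  | succ r ih =>
    intro x m hx hs
    rw [show c + ((r + 1 : ℕ) : ℝ) * b = c + r * b + b by push_cast; ring]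
    -- A far-out `true` lowers the counter by one and moves `F` by `a j`, hence `G` by at least `a j
    -- - 2 * η`.
    refine Oscillates.of_frequently_jump hf (b' := a j - 2 * η) (by linarith)
      ((tendsto_update_true x).frequently (Eventually.frequently ?_))
    filter_upwards [eventually_ge_atTop m] with n hn
    have hu := blockState_update (ℓ := ℓ) hx hn
    have hy : blockState ℓ (Function.update x n true) (n + 1) = (j, r) := by
      rw [blockState_succ_of_true_of_ne (by simp) (by simp [hu, hs]), hu, hs]
      simp
    have hy0 := update_true_eq_false hx hn
    refine ⟨?_, ih _ _ hy0 hy⟩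
    have e : |F (Function.update x n true) - F x| = a j := by
      rw [limit_eq_blockValue hF hy0, limit_eq_blockValue hF hx, hy, hs,
        abs_blockValue_sub_pred, abs_of_nonneg ha]
    have h1 := hGF x
    have h2 := hGF (Function.update x n true)
    rw [← e]
    rw [abs_sub_comm] at h2
    have h3 := abs_add_three (F (Function.update x n true) - G (Function.update x n true))
      (G (Function.update x n true) - G x) (G x - F x)
    rw [show F (Function.update x n true) - G (Function.update x n true) +
      (G (Function.update x n true) - G x) + (G x - F x) =
      F (Function.update x n true) - F x by ring] at h3
    linarith

theorem variation_lower_bound {F G : (ℕ → Bool) → ℝ}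
    (hF : ∀ x, Tendsto (fun n => blockFun ℓ a n x) atTop (𝓝 (F x))) {j : ℕ} (ha : 0 ≤ a j)
    {b η : ℝ} (hb : b + 2 * η < a j) (hGF : ∀ x, |G x - F x| ≤ η) {C : ℝ≥0}
    (hG : HasVariationBound G C) : ℓ 0 j * b ≤ C + 1 := by
  obtain ⟨f, -, hf, hs⟩ := hasVariationBound_iff.1 hG
  have hx : ∀ i, 0 ≤ i → (fun _ => false : ℕ → Bool) i = false := fun _ _ => rfl
  have hu := blockState_update (ℓ := ℓ) hx j.zero_le
  have h := oscillates_of_counter hF hGF hf ha hb (c := -1)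
    (fun x _ _ _ => Oscillates.of_neg f x (by norm_num)) (ℓ 0 j) _ (j + 1)
    (update_true_eq_false hx j.zero_le)
    (by rw [blockState_succ_of_true_of_zero (by simp) (by simp [hu, blockState]), hu]; rfl)
  linarith [h.lt_of_variation_le hs]

theorem not_mem_DBSC_of_recurrent {F : (ℕ → Bool) → ℝ}
    (hF : ∀ x, Tendsto (fun n => blockFun ℓ a n x) atTop (𝓝 (F x))) (ha : ∀ j, 0 < a j)
    (hℓ : ∀ i j, 2 ≤ ℓ i j * a j) : F ∉ DBSC (ℕ → Bool) := by
  rintro ⟨C, hC⟩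
  obtain ⟨f, -, hf, hs⟩ := hasVariationBound_iff.1 hC
  -- Each further block opened far out adds at least 1, as `ℓ i n * (a n / 2) ≥ 1`. The start `-1`
  -- makes the strict inequality in `Oscillates` trivial.
  have main : ∀ t : ℕ, ∀ x m, (∀ i, m ≤ i → x i = false) → (blockState ℓ x m).2 = 0 →
      Oscillates f x (-1 + t) := by
    intro t
    induction t with
    | zero => exact fun x m _ _ => Oscillates.of_neg f x (by norm_num)
    | succ t ih =>
      intro x m hx h0
      refine Oscillates.of_frequently
        ((tendsto_update_true x).frequently (Eventually.frequently ?_))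
      filter_upwards [eventually_ge_atTop m] with n hn
      have hu := blockState_update (ℓ := ℓ) hx hn
      have h := oscillates_of_counter hF (η := 0) (by simp) hf (ha n).le (b := a n / 2)
        (by linarith [ha n]) ih _ _ (n + 1) (update_true_eq_false hx hn)
        (blockState_succ_of_true_of_zero (by simp) (by rw [hu, h0]))
      refine h.mono ?_
      have := hℓ (blockState ℓ (Function.update x n true) n).1 n
      push_cast
      linarith
  obtain ⟨t, ht⟩ := exists_nat_ge ((C : ℝ) + 1)
  have := (main t (fun _ => false) 0 (fun _ _ => rfl) rfl).lt_of_variation_le hs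
  linarith

theorem exists_mem_BQuarter_not_mem_DBSC :
    ∃ F ∈ BQuarter (ℕ → Bool), F ∉ DBSC (ℕ → Bool) := by
  have e : ∀ j : ℕ, ((2 * (j + 1) : ℕ) : ℝ) * harmonicWeight j = 2 := fun j => by
    unfold harmonicWeight
    push_cast
    field_simp
  obtain ⟨F, h1, hF, G, hG, hu⟩ := exists_limit_harmonic (ℓ := fun _ j => 2 * (j + 1))
    (B := fun _ => 2) (fun N i j _ => (e j).le)
  exact ⟨F, mem_BQuarter_iff.2 ⟨h1, _, G, hG, hu⟩,
    not_mem_DBSC_of_recurrent hF harmonicWeight_pos fun _ j => (e j).ge⟩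

theorem exists_mem_BHalf_not_mem_BQuarter :
    ∃ F ∈ BHalf (ℕ → Bool), F ∉ BQuarter (ℕ → Bool) := by
  have e : ∀ j : ℕ, (((j + 1) ^ 2 : ℕ) : ℝ) * harmonicWeight j = j + 1 := fun j => by
    unfold harmonicWeight
    push_cast
    field_simp
  obtain ⟨F, h1, hF, G, hG, hu⟩ := exists_limit_harmonic (ℓ := fun _ j => (j + 1) ^ 2)
    (B := fun N => N) (fun N i j h => (e j).trans_le (by exact_mod_cast h))
  refine ⟨F, ⟨h1, G, fun N => ⟨_, hG N⟩, hu⟩, fun hq => ?_⟩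
  obtain ⟨-, C, H, hH, hHu⟩ := mem_BQuarter_iff.1 hq
  obtain ⟨j, hj⟩ := exists_nat_gt (2 * ((C : ℝ) + 1))
  have hw := harmonicWeight_pos j
  obtain ⟨N, hN⟩ := (Metric.tendstoUniformly_iff.1 hHu (harmonicWeight j / 8)
    (by positivity)).exists
  have h := variation_lower_bound hF hw.le (b := harmonicWeight j / 2)
    (η := harmonicWeight j / 8) (by linarith)
    (fun x => by simpa [Real.dist_eq, abs_sub_comm] using (hN x).le) (hH N)
  have := e j
  linarith

theorem exists_mem_B1_not_mem_BHalf :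
    ∃ F ∈ B1 (ℕ → Bool), F ∉ BHalf (ℕ → Bool) := by
  -- Only a block opened from index `0` has positive length. A `true` at position 0 leaves the state
  -- `(0, 0)` unchanged, so the long block may still come later.
  set ℓ : ℕ → ℕ → ℕ := fun i j => if i = 0 then j else 0 with hℓ
  have inv : ∀ x n, (blockState ℓ x n).1 = 0 → (blockState ℓ x n).2 = 0 := by
    intro x n
    induction n with
    | zero => exact fun _ => rfl
    | succ n ih =>
      rcases Bool.eq_false_or_eq_true (x n) with h | h
      · by_cases h0 : (blockState ℓ x n).2 = 0
        · rw [blockState_succ_of_true_of_zero h h0]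
          rintro rfl
          simp [hℓ]
        · rw [blockState_succ_of_true_of_ne h h0]
          exact fun h1 => absurd (ih h1) h0
      · rwa [blockState_succ_of_false h]
  have step : ∀ x n, (blockState ℓ x n).1 ≠ 0 → (blockState ℓ x (n + 1)).1 ≠ 0 ∧
      (blockState ℓ x (n + 1)).2 ≤ (blockState ℓ x n).2 := by
    intro x n hn
    rcases Bool.eq_false_or_eq_true (x n) with h | h
    · by_cases h0 : (blockState ℓ x n).2 = 0
      · rw [blockState_succ_of_true_of_zero h h0]
        refine ⟨?_, (if_neg hn).trans_le (Nat.zero_le _)⟩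
        rintro h1
        simp only at h1
        subst h1
        exact hn rfl
      · rw [blockState_succ_of_true_of_ne h h0]
        exact ⟨hn, Nat.sub_le _ _⟩
    · rw [blockState_succ_of_false h]
      exact ⟨hn, le_rfl⟩
  -- Once the index is nonzero the counter never increases, so it stabilises; this gives pointwise
  -- convergence although the weights do not tend to zero.
  have hconst : ∀ x, ∃ r M, ∀ n, M ≤ n → (blockState ℓ x n).2 = r := by
    intro x
    by_cases hx : ∀ n, (blockState ℓ x n).1 = 0
    · exact ⟨0, 0, fun n _ => inv x n (hx n)⟩
    push Not at hx
    obtain ⟨M, hM⟩ := hx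
    have hne : ∀ n, (blockState ℓ x (M + n)).1 ≠ 0 := by
      intro n
      induction n with
      | zero => exact hM
      | succ n ih => exact (step x _ ih).1
    have hanti : Antitone fun n => (blockState ℓ x (M + n)).2 :=
      antitone_nat_of_succ_le fun n => (step x _ (hne n)).2
    obtain ⟨N, hN⟩ := WellFoundedGT.monotone_chain_condition
      (α := ℕᵒᵈ) ⟨fun n => OrderDual.toDual (blockState ℓ x (M + n)).2, fun _ _ h => hanti h⟩
    refine ⟨(blockState ℓ x (M + N)).2, M + N, fun n hn => ?_⟩
    obtain ⟨k, rfl⟩ := Nat.exists_eq_add_of_le (le_trans (Nat.le_add_right M N) hn)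
    exact (hN k (by lia)).symm
  choose r M hr using hconst
  have hF : ∀ x, Tendsto (fun n => blockFun ℓ (fun _ => 1) n x) atTop
      (𝓝 (if Odd (r x) then 1 else 0)) := by
    intro x
    refine tendsto_const_nhds.congr' ?_
    filter_upwards [eventually_ge_atTop (M x)] with n hn
    rw [blockFun_apply, blockValue, hr x n hn]
  refine ⟨fun x => if Odd (r x) then 1 else 0, ⟨blockFun ℓ fun _ => 1,
    ⟨1, fun n x => abs_blockValue_le (fun _ => abs_one.le) _⟩, hF⟩, ?_⟩
  rintro ⟨-, G, hG, hu⟩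
  obtain ⟨N, hN⟩ := (Metric.tendstoUniformly_iff.1 hu (1 / 8) (by norm_num)).exists
  obtain ⟨C, hC⟩ := hG N
  obtain ⟨j, hj⟩ := exists_nat_gt (2 * ((C : ℝ) + 1))
  have h := variation_lower_bound hF (j := j) zero_le_one (b := 1 / 2) (η := 1 / 8) (by norm_num)
    (fun x => by have := (hN x).le; rwa [Real.dist_eq, abs_sub_comm] at this) hC
  simp only [hℓ, if_true] at h
  linarith

end Lower

/-! ### The Cantor set inside `K`, and the conclusion. -/

theorem exists_isClosedEmbedding_cantor (K : Type*) [MetricSpace K] [CompactSpace K]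
    [Uncountable K] : ∃ φ : (ℕ → Bool) → K, IsClosedEmbedding φ := by
  obtain ⟨φ, -, hc, hi⟩ := isClosed_univ.exists_nat_bool_injection_of_not_countable (α := K)
    fun h => not_countable (Set.countable_univ_iff.1 h)
  exact ⟨φ, hc.isClosedEmbedding hi⟩

end BaireOne

theorem proposition5p1 (K : Type*) [MetricSpace K] [CompactSpace K] [Uncountable K] :
    BaireOne.CK K ⊂ BaireOne.DBSC K ∧
    BaireOne.DBSC K ⊂ BaireOne.BQuarter K ∧
    BaireOne.BQuarter K ⊂ BaireOne.BHalf K ∧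
    BaireOne.BHalf K ⊂ BaireOne.B1 K := by
  obtain ⟨φ, hφ⟩ := BaireOne.exists_isClosedEmbedding_cantor K
  let ψ : C(ℕ → Bool, K) := ⟨φ, hφ.continuous⟩
  have hψ : ∀ F : (ℕ → Bool) → ℝ, Function.extend φ F 0 ∘ ψ = F := fun F =>
    Function.extend_comp hφ.injective F 0
  refine ⟨⟨BaireOne.CK_subset_DBSC, BaireOne.not_DBSC_subset_CK⟩,
    ⟨BaireOne.DBSC_subset_BQuarter, fun hsub => ?_⟩,
    ⟨BaireOne.BQuarter_subset_BHalf, fun hsub => ?_⟩, ⟨fun F hF => hF.1, fun hsub => ?_⟩⟩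
  · obtain ⟨F, hF, hnot⟩ := BaireOne.exists_mem_BQuarter_not_mem_DBSC
    obtain ⟨C, hC⟩ := hsub (BaireOne.BQuarter_extend hφ hF)
    exact hnot ⟨C, hψ F ▸ hC.comp ψ⟩
  · obtain ⟨F, hF, hnot⟩ := BaireOne.exists_mem_BHalf_not_mem_BQuarter
    exact hnot (hψ F ▸ BaireOne.BQuarter_comp (hsub (BaireOne.BHalf_extend hφ hF)) ψ)
  · obtain ⟨F, hF, hnot⟩ := BaireOne.exists_mem_B1_not_mem_BHalf
    exact hnot (hψ F ▸ BaireOne.BHalf_comp (hsub (BaireOne.B1_extend hφ hF)) ψ)
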